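/- Consider the types $A,B ::= \mathtt{Int}\mid\top\mid\alpha\mid A\to B\mid\mu\alpha.A$, identified up to renaming of bound variables, where $A[\alpha\mapsto B]$ denotes capture-avoiding substitution. Equi-recursive equality $A\doteq B$ is the least equivalence relation on types such that: (i) $\mu\alpha.A\doteq A[\alpha\mapsto\mu\alpha.A]$; (ii) $A\doteq B$ implies $\mu\alpha.A\doteq\mu\alpha.B$; (iii) $A_1\doteq B_1$ and $A_2\doteq B_2$ imply $A_1\to A_2\doteq B_1\to B_2$; (iv) if $B_1\doteq A[\alpha\mapsto B_1]$ and $B_2\doteq A[\alpha\mapsto B_2]$, where $A$ is contractive in $\alpha$ (i.e. $\alpha$ is not free in $A$, or $A$ can be turned into a function type $A_1\to A_2$ by repeatedly replacing $\mu\beta.C$ with $C[\beta\mapsto\mu\beta.C]$), then $B_1\doteq B_2$. Let $\Sigma$ range over finite lists of assumptions $\alpha\le\beta$ between type variables, and write $\cdot$ for the empty list. The relations $\Sigma\vdash A\le_e B$ (equi-recursive Amber subtyping) and $\Sigma\vdash A\le_i B$ (iso-recursive Amber subtyping) are inductively defined as follows. Rules of both relations ($\oplus\in\{e,i\}$): -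 $\Sigma\vdash A\le_\oplus\top$; - $\Sigma\vdash\alpha\le_\oplus\beta$ if $(\alpha\le\beta)\in\Sigma$; - $\Sigma\vdash A_1\to A_2\le_\oplus B_1\to B_2$ if $\Sigma\vdash B_1\le_\oplus A_1$ and $\Sigma\vdash A_2\le_\oplus B_2$; - $\Sigma\vdash\mu\alpha.A\le_\oplus\mu\beta.B$ if $\Sigma,\alpha\le\beta\vdash A\le_\oplus B$, where $\alpha\neq\beta$ do not occur in $\Sigma$, $\alpha$ is not free in $B$ and $\beta$ is not free in $A$. Rules of $\le_e$ only: - $\Sigma\vdash A\le_e B$ if $A\doteq B$; - $\Sigma\vdash A\le_e C$ if $\Sigma\vdash A\le_e B$ and $\Sigma\vdash B\le_e C$. Rules of $\le_i$ only: - $\Sigma\vdash\mathtt{Int}\le_i\mathtt{Int}$; - $\Sigma\vdash\mu\alpha.A\le_i\mu\alpha.A$. **Theorem (equi-recursive subtyping decomposition).** For all closed types $A$ and $B$, $\cdot\vdash A\le_e B$ if and only if there exist closed types $C_1$ and $C_2$ such that $A\doteq C_1$, $\cdot\vdash C_1\le_i C_2$ and $C_2\doteq B$. -/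

import Mathlib

namespace RecTypes

/-- Types with free type variables among `α₀, …, αₙ₋₁`, up to renaming of bound variables
(well-scoped de Bruijn indices): `Int`, `⊤`, `α`, `A → B` and `μ α. A`.
In `mu A` the variable bound by `μ` is the variable `0` of the body `A`, and the variable `i` of
the ambient scope is the variable `i + 1` of the body. Closed types are the elements of `Ty 0`. -/
inductive Ty : ℕ → Type
  | int {n : ℕ} : Ty n
  | top {n : ℕ} : Ty n
  | var {n : ℕ} (i : Fin n) : Ty n
  | arrow {n : ℕ} (A B : Ty n) : Ty n
  | mu {n : ℕ} (A : Ty (n + 1)) : Ty n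

/-- Extension of a renaming under a binder: the bound variable is kept. -/
def liftRen {m n : ℕ} (r : Fin m → Fin n) : Fin (m + 1) → Fin (n + 1) :=
  Fin.cases 0 (fun i => (r i).succ)

/-- Capture-avoiding renaming of the free variables. -/
def Ty.rename : {m n : ℕ} → (Fin m → Fin n) → Ty m → Ty n
  | _, _, _, .int => .int
  | _, _, _, .top => .top
  | _, _, r, .var i => .var (r i)
  | _, _, r, .arrow A B => .arrow (A.rename r) (B.rename r)
  | _, _, r, .mu A => .mu (A.rename (liftRen r))

/-- Extension of a substitution under a binder: the bound variable is kept. -/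
def liftSub {m n : ℕ} (s : Fin m → Ty n) : Fin (m + 1) → Ty (n + 1) :=
  Fin.cases (.var 0) (fun i => (s i).rename Fin.succ)

/-- Capture-avoiding simultaneous substitution for the free variables. -/
def Ty.subst : {m n : ℕ} → (Fin m → Ty n) → Ty m → Ty n
  | _, _, _, .int => .int
  | _, _, _, .top => .top
  | _, _, s, .var i => s i
  | _, _, s, .arrow A B => .arrow (A.subst s) (B.subst s)
  | _, _, s, .mu A => .mu (A.subst (liftSub s))

/-- `A.inst B` is `A[α ↦ B]`, where `α` is the variable `0` of `A`. -/
def Ty.inst {n : ℕ} (A : Ty (n + 1)) (B : Ty n) : Ty n :=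
  A.subst (Fin.cases B Ty.var)

/-- The variable `i` occurs free in the type. -/
def Ty.Occurs : {n : ℕ} → Fin n → Ty n → Prop
  | _, _, .int => False
  | _, _, .top => False
  | _, i, .var j => i = j
  | _, i, .arrow A B => A.Occurs i ∨ B.Occurs i
  | _, i, .mu A => A.Occurs i.succ

/-- One unfolding of a recursive type: `μ α. A` becomes `A[α ↦ μ α. A]`. -/
inductive UnfoldStep {n : ℕ} : Ty n → Ty n → Prop
  | unfold (A : Ty (n + 1)) : UnfoldStep (.mu A) (A.inst (.mu A))

/-- `A` is contractive in the variable `i`: either the variable is not free in `A`, or `A` can be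
unfolded to a function type. -/
def Contractive {n : ℕ} (A : Ty n) (i : Fin n) : Prop :=
  ¬ A.Occurs i ∨ ∃ A₁ A₂ : Ty n, Relation.ReflTransGen UnfoldStep A (.arrow A₁ A₂)

/-- Equi-recursive type equality `A ≐ B` (Amadio and Cardelli's axiomatization). -/
inductive TyEq : {n : ℕ} → Ty n → Ty n → Prop
  | contract {n : ℕ} {B₁ B₂ : Ty n} (A : Ty (n + 1)) :
      TyEq B₁ (A.inst B₁) → TyEq B₂ (A.inst B₂) → Contractive A 0 → TyEq B₁ B₂
  | unfold {n : ℕ} (A : Ty (n + 1)) : TyEq (.mu A) (A.inst (.mu A))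
  | mu_cong {n : ℕ} {A B : Ty (n + 1)} : TyEq A B → TyEq (.mu A) (.mu B)
  | trans {n : ℕ} {A B C : Ty n} : TyEq A B → TyEq B C → TyEq A C
  | refl {n : ℕ} (A : Ty n) : TyEq A A
  | symm {n : ℕ} {A B : Ty n} : TyEq A B → TyEq B A
  | arrow {n : ℕ} {A₁ A₂ B₁ B₂ : Ty n} :
      TyEq A₁ B₁ → TyEq A₂ B₂ → TyEq (.arrow A₁ A₂) (.arrow B₁ B₂)

/-- The two flavours of subtyping: iso-recursive and equi-recursive. -/
inductive Mode
  | iso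
  | equi

/-- Subtyping environments: lists of assumptions `α ≤ β` between type variables in scope. -/
abbrev Env (n : ℕ) : Type := List (Fin n × Fin n)

/-- The environment `Σ, α ≤ β` for two fresh variables, `α` being the variable `1` and `β` the
variable `0` of the enlarged scope. -/
def Env.extend {n : ℕ} (E : Env n) : Env (n + 2) :=
  (1, 0) :: E.map (fun p => (p.1.succ.succ, p.2.succ.succ))

/-- The body of `μ α. A` in the scope enlarged by fresh `α` and `β`, the bound variable being `α`
(the variable `1`); in particular `β` is not free in it. -/
def Ty.leftBody {n : ℕ} (A : Ty (n + 1)) : Ty (n + 2) :=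
  A.rename (Fin.cases 1 (fun i => i.succ.succ))

/-- The body of `μ β. B` in the scope enlarged by fresh `α` and `β`, the bound variable being `β`
(the variable `0`); in particular `α` is not free in it. -/
def Ty.rightBody {n : ℕ} (B : Ty (n + 1)) : Ty (n + 2) :=
  B.rename (Fin.cases 0 (fun i => i.succ.succ))

/-- The Amber rules: `Sub .equi E A B` is equi-recursive subtyping `E ⊢ A ≤ₑ B`, and
`Sub .iso E A B` is iso-recursive subtyping `E ⊢ A ≤ᵢ B`. The rules `int` and `self` belong to
iso-recursive subtyping only, `eq` and `trans` to equi-recursive subtyping only, and the other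
rules to both. -/
inductive Sub : Mode → {n : ℕ} → Env n → Ty n → Ty n → Prop
  | top {m : Mode} {n : ℕ} {E : Env n} (A : Ty n) : Sub m E A .top
  | int {n : ℕ} {E : Env n} : Sub .iso E .int .int
  | eq {n : ℕ} {E : Env n} {A B : Ty n} : TyEq A B → Sub .equi E A B
  | var {m : Mode} {n : ℕ} {E : Env n} {a b : Fin n} :
      (a, b) ∈ E → Sub m E (.var a) (.var b)
  | self {n : ℕ} {E : Env n} (A : Ty (n + 1)) : Sub .iso E (.mu A) (.mu A)
  | trans {n : ℕ} {E : Env n} {A B C : Ty n} :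
      Sub .equi E A B → Sub .equi E B C → Sub .equi E A C
  | arrow {m : Mode} {n : ℕ} {E : Env n} {A₁ A₂ B₁ B₂ : Ty n} :
      Sub m E B₁ A₁ → Sub m E A₂ B₂ → Sub m E (.arrow A₁ A₂) (.arrow B₁ B₂)
  | mu {m : Mode} {n : ℕ} {E : Env n} {A B : Ty (n + 1)} :
      Sub m E.extend A.leftBody B.rightBody → Sub m E (.mu A) (.mu B)

end RecTypes

namespace RecTypes

/-! ### Renaming and substitution -/

/-! From right to left, every iso-recursive rule is admissible for equi-recursive subtyping
(`Sub.to_equi`). From left to right, a derivation may pass through arbitrary intermediate types by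
transitivity, so the argument goes through semantics.

A type denotes an infinite tree, `μ` being the limit of iterates from a meaningless tree. Equal
types have equal trees (`TyEq.denote_eq`), because contractive equations have unique solutions.
Subtyping implies the transitive relation `Le k` on trees at every depth `k` (`Sub.denote_le`).

Conversely, the tree of a type is regular: up to `≐`, its subtrees come from a finite set of types
(`Ty.exists_shapes`). Two related trees are traversed in parallel (`exists_synchronized`). A state
is a pair of subtrees with the current variance. A new state with arrows at both roots opens a `μ`
on both sides at once; a state seen before becomes its variable. Both results thus have matching
binders, so the Amber rules apply directly, and they equal the original types by the contraction
rule (`TyEq.mu_of_arrow`). Only finitely many states exist, so the traversal ends. -/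

theorem liftRen_comp {l m n : ℕ} (r : Fin m → Fin n) (q : Fin l → Fin m) :
    liftRen r ∘ liftRen q = liftRen (r ∘ q) := by
  funext i
  cases i using Fin.cases <;> rfl

theorem Ty.rename_rename {l : ℕ} (A : Ty l) : ∀ {m n : ℕ} (q : Fin l → Fin m) (r : Fin m → Fin n),
    (A.rename q).rename r = A.rename (r ∘ q) := by
  induction A with
  | int => intros; rfl
  | top => intros; rfl
  | var i => intros; rfl
  | arrow A B ihA ihB => intros; simp only [Ty.rename, ihA, ihB]
  | mu A ih => intros; simp only [Ty.rename, ih, liftRen_comp]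

theorem liftSub_comp_liftRen {l m n : ℕ} (s : Fin m → Ty n) (q : Fin l → Fin m) :
    liftSub s ∘ liftRen q = liftSub (s ∘ q) := by
  funext i
  cases i using Fin.cases <;> rfl

theorem Ty.subst_rename {l : ℕ} (A : Ty l) : ∀ {m n : ℕ} (q : Fin l → Fin m) (s : Fin m → Ty n),
    (A.rename q).subst s = A.subst (s ∘ q) := by
  induction A with
  | int => intros; rfl
  | top => intros; rfl
  | var i => intros; rfl
  | arrow A B ihA ihB => intros; simp only [Ty.rename, Ty.subst, ihA, ihB]
  | mu A ih => intros; simp only [Ty.rename, Ty.subst, ih, liftSub_comp_liftRen]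

theorem rename_liftSub {l m n : ℕ} (s : Fin l → Ty m) (r : Fin m → Fin n) :
    (fun i => (liftSub s i).rename (liftRen r)) = liftSub (fun i => (s i).rename r) := by
  funext i
  cases i using Fin.cases with
  | zero => rfl
  | succ i =>
    change ((s i).rename Fin.succ).rename (liftRen r) = ((s i).rename r).rename Fin.succ
    rw [Ty.rename_rename, Ty.rename_rename]
    rfl

theorem Ty.rename_subst {l : ℕ} (A : Ty l) : ∀ {m n : ℕ} (s : Fin l → Ty m) (r : Fin m → Fin n),
    (A.subst s).rename r = A.subst (fun i => (s i).rename r) := by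
  induction A with
  | int => intros; rfl
  | top => intros; rfl
  | var i => intros; rfl
  | arrow A B ihA ihB => intros; simp only [Ty.rename, Ty.subst, ihA, ihB]
  | mu A ih => intros; simp only [Ty.rename, Ty.subst, ih, rename_liftSub]

theorem subst_liftSub {l m n : ℕ} (s : Fin l → Ty m) (t : Fin m → Ty n) :
    (fun i => (liftSub s i).subst (liftSub t)) = liftSub (fun i => (s i).subst t) := by
  funext i
  cases i using Fin.cases with
  | zero => rfl
  | succ i =>
    change ((s i).rename Fin.succ).subst (liftSub t) = ((s i).subst t).rename Fin.succ
    rw [Ty.subst_rename, Ty.rename_subst]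
    rfl

theorem Ty.subst_subst {l : ℕ} (A : Ty l) : ∀ {m n : ℕ} (s : Fin l → Ty m) (t : Fin m → Ty n),
    (A.subst s).subst t = A.subst (fun i => (s i).subst t) := by
  induction A with
  | int => intros; rfl
  | top => intros; rfl
  | var i => intros; rfl
  | arrow A B ihA ihB => intros; simp only [Ty.subst, ihA, ihB]
  | mu A ih => intros; simp only [Ty.subst, ih, subst_liftSub]

theorem liftSub_var {n : ℕ} : liftSub (Ty.var : Fin n → Ty n) = Ty.var := by
  funext i
  cases i using Fin.cases <;> rfl

theorem Ty.subst_var {n : ℕ} (A : Ty n) : A.subst Ty.var = A := by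
  induction A with
  | int => rfl
  | top => rfl
  | var i => rfl
  | arrow A B ihA ihB => simp only [Ty.subst, ihA, ihB]
  | mu A ih => simp only [Ty.subst, liftSub_var, ih]

theorem Ty.inst_subst_liftSub {m n : ℕ} (A : Ty (m + 1)) (s : Fin m → Ty n) (B : Ty n) :
    (A.subst (liftSub s)).inst B = A.subst (Fin.cases B s) := by
  rw [Ty.inst, Ty.subst_subst]
  congr 1
  funext i
  cases i using Fin.cases with
  | zero => rfl
  | succ i =>
    change ((s i).rename Fin.succ).subst _ = s i
    rw [Ty.subst_rename]
    exact Ty.subst_var _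

theorem Ty.subst_inst {m n : ℕ} (A : Ty (m + 1)) (B : Ty m) (s : Fin m → Ty n) :
    (A.inst B).subst s = (A.subst (liftSub s)).inst (B.subst s) := by
  rw [Ty.inst_subst_liftSub, Ty.inst, Ty.subst_subst]
  congr 1
  funext i
  cases i using Fin.cases <;> rfl

/-- Closed types are invariant under weakening followed by substitution. -/
theorem Ty.subst_weaken {n : ℕ} (A : Ty 0) (s : Fin n → Ty 0) :
    (A.rename Fin.elim0).subst s = A := by
  rw [Ty.subst_rename]
  conv_rhs => rw [← Ty.subst_var A]
  congr 1
  funext i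
  exact i.elim0

/-! ### Type equality is closed under substitution -/

theorem Ty.Occurs.of_rename {m : ℕ} {A : Ty m} : ∀ {n : ℕ} {r : Fin m → Fin n} {i : Fin n},
    (A.rename r).Occurs i → ∃ j, A.Occurs j ∧ i = r j := by
  induction A with
  | int => intro _ _ _ h; exact h.elim
  | top => intro _ _ _ h; exact h.elim
  | var j => intro _ _ _ h; exact ⟨j, rfl, h⟩
  | arrow A B ihA ihB =>
    intro _ _ _ h
    rcases h with h | h
    · obtain ⟨j, hj, e⟩ := ihA h
      exact ⟨j, Or.inl hj, e⟩
    · obtain ⟨j, hj, e⟩ := ihB h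
      exact ⟨j, Or.inr hj, e⟩
  | mu A ih =>
    intro _ r i h
    obtain ⟨j, hj, e⟩ := ih h
    cases j using Fin.cases with
    | zero => exact absurd e (Fin.succ_ne_zero _)
    | succ j => exact ⟨j, hj, Fin.succ_injective _ e⟩

theorem Ty.Occurs.of_subst {m : ℕ} {A : Ty m} : ∀ {n : ℕ} {s : Fin m → Ty n} {i : Fin n},
    (A.subst s).Occurs i → ∃ j, A.Occurs j ∧ (s j).Occurs i := by
  induction A with
  | int => intro _ _ _ h; exact h.elim
  | top => intro _ _ _ h; exact h.elim
  | var j => intro _ _ _ h; exact ⟨j, rfl, h⟩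
  | arrow A B ihA ihB =>
    intro _ _ _ h
    rcases h with h | h
    · obtain ⟨j, hj, e⟩ := ihA h
      exact ⟨j, Or.inl hj, e⟩
    · obtain ⟨j, hj, e⟩ := ihB h
      exact ⟨j, Or.inr hj, e⟩
  | mu A ih =>
    intro _ s i h
    obtain ⟨j, hj, e⟩ := ih h
    cases j using Fin.cases with
    | zero => exact absurd e (Fin.succ_ne_zero _)
    | succ j =>
      obtain ⟨k, hk, e⟩ := Ty.Occurs.of_rename (A := s j) e
      exact ⟨j, hj, Fin.succ_injective _ e ▸ hk⟩

theorem UnfoldStep.subst {m n : ℕ} {A B : Ty m} (s : Fin m → Ty n) (h : UnfoldStep A B) :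
    UnfoldStep (A.subst s) (B.subst s) := by
  cases h with
  | unfold A =>
    rw [Ty.subst_inst]
    exact UnfoldStep.unfold _

/-- The substituted types are weakened past the variable `0`, so they cannot reintroduce it, and
unfolding commutes with substitution. -/
theorem Contractive.subst {m n : ℕ} {A : Ty (m + 1)} (s : Fin m → Ty n) (h : Contractive A 0) :
    Contractive (A.subst (liftSub s)) 0 := by
  rcases h with h | ⟨A₁, A₂, h⟩
  · left
    intro ho
    obtain ⟨j, hj, e⟩ := ho.of_subst
    cases j using Fin.cases with
    | zero => exact h hj
    | succ j =>
      obtain ⟨k, -, e⟩ := Ty.Occurs.of_rename (A := s j) e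
      exact Fin.succ_ne_zero _ e.symm
  · exact Or.inr ⟨_, _, h.lift (Ty.subst (liftSub s)) fun _ _ => UnfoldStep.subst _⟩

theorem TyEq.subst {m : ℕ} {A B : Ty m} (h : TyEq A B) :
    ∀ {n : ℕ} (s : Fin m → Ty n), TyEq (A.subst s) (B.subst s) := by
  induction h with
  | contract A _ _ hA ih₁ ih₂ =>
    intro _ s
    have h₁ := ih₁ s
    have h₂ := ih₂ s
    rw [Ty.subst_inst] at h₁ h₂
    exact .contract _ h₁ h₂ (hA.subst s)
  | unfold A =>
    intro _ s
    rw [Ty.subst_inst]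
    exact .unfold _
  | mu_cong _ ih => exact fun s => .mu_cong (ih _)
  | trans _ _ ih₁ ih₂ => exact fun s => (ih₁ s).trans (ih₂ s)
  | refl A => exact fun s => .refl _
  | symm _ ih => exact fun s => (ih s).symm
  | arrow _ _ ih₁ ih₂ => exact fun s => .arrow (ih₁ s) (ih₂ s)

/-! ### Infinite trees -/

/-- Node labels of the infinite trees denoted by types; `bot` labels the meaningless tree. -/
inductive Label
  | bot
  | int
  | top
  | arrow

/-- Infinite binary trees. Only the nodes below nodes labelled `Label.arrow` are relevant. -/
abbrev Tree : Type := List Bool → Label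

namespace Tree

/-- The tree of a function type. -/
def node (t u : Tree) : Tree
  | [] => .arrow
  | false :: p => t p
  | true :: p => u p

/-- The subtree at a child of the root. -/
def child (b : Bool) (t : Tree) : Tree := fun p => t (b :: p)

/-- Equality of trees at all nodes of depth less than `k`. -/
def EqUpTo (k : ℕ) (t u : Tree) : Prop := ∀ p : List Bool, p.length < k → t p = u p

theorem EqUpTo.refl (k : ℕ) (t : Tree) : EqUpTo k t t := fun _ _ => rfl

theorem EqUpTo.symm {k : ℕ} {t u : Tree} (h : EqUpTo k t u) : EqUpTo k u t :=
  fun p hp => (h p hp).symm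

theorem EqUpTo.trans {k : ℕ} {t u v : Tree} (h : EqUpTo k t u) (h' : EqUpTo k u v) :
    EqUpTo k t v :=
  fun p hp => (h p hp).trans (h' p hp)

theorem EqUpTo.mono {k l : ℕ} {t u : Tree} (hkl : k ≤ l) (h : EqUpTo l t u) : EqUpTo k t u :=
  fun p hp => h p (hp.trans_le hkl)

theorem eq_of_eqUpTo {t u : Tree} (h : ∀ k, EqUpTo k t u) : t = u :=
  funext fun p => h (p.length + 1) p (Nat.lt_succ_self _)

theorem EqUpTo.node {k : ℕ} {t u t' u' : Tree} (h : EqUpTo k t t') (h' : EqUpTo k u u') :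
    EqUpTo (k + 1) (node t u) (node t' u')
  | [], _ => rfl
  | false :: p, hp => h p (Nat.lt_of_succ_lt_succ hp)
  | true :: p, hp => h' p (Nat.lt_of_succ_lt_succ hp)

theorem EqUpTo.child {k : ℕ} {t u : Tree} (h : EqUpTo (k + 1) t u) (b : Bool) :
    EqUpTo k (child b t) (child b u) :=
  fun p hp => h (b :: p) (Nat.succ_lt_succ hp)

/-- The limit of the iterates of a function, starting from the meaningless tree. -/
def lim (f : Tree → Tree) : Tree := fun p => (f^[p.length + 1] fun _ => .bot) p

theorem lim_eqUpTo_lim {k : ℕ} {f g : Tree → Tree}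
    (h : ∀ t u, EqUpTo k t u → EqUpTo k (f t) (g u)) : EqUpTo k (lim f) (lim g) := by
  have key : ∀ m, EqUpTo k (f^[m] fun _ => .bot) (g^[m] fun _ => .bot) := by
    intro m
    induction m with
    | zero => exact .refl _ _
    | succ m ih =>
      rw [Function.iterate_succ_apply', Function.iterate_succ_apply']
      exact h _ _ ih
  exact fun p hp => key _ p hp

/-- A function on trees that is the identity or brings trees closer together. -/
def Guarded (f : Tree → Tree) : Prop :=
  (∀ t, f t = t) ∨ ∀ k t u, EqUpTo k t u → EqUpTo (k + 1) (f t) (f u)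

/-- For a contracting map, all iterates of index at least `j` agree below depth `j`; for the
identity, all iterates are the meaningless tree. -/
theorem Guarded.lim_eqUpTo_iterate {f : Tree → Tree} (hf : Guarded f) {k m : ℕ} (hkm : k ≤ m) :
    EqUpTo k (lim f) (f^[m] fun _ => .bot) := by
  rcases hf with hf | hf
  · obtain rfl : f = id := funext hf
    intro p _
    simp only [lim, Function.iterate_id]
  · have key : ∀ j m m', j ≤ m → j ≤ m' →
        EqUpTo j (f^[m] fun _ => .bot) (f^[m'] fun _ => .bot) := by
      intro j
      induction j with
      | zero => exact fun _ _ _ _ p hp => absurd hp (Nat.not_lt_zero _)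
      | succ j ih =>
        intro m m' hm hm'
        obtain ⟨m, rfl⟩ := Nat.exists_eq_add_of_le' (Nat.one_le_of_lt hm)
        obtain ⟨m', rfl⟩ := Nat.exists_eq_add_of_le' (Nat.one_le_of_lt hm')
        rw [Function.iterate_succ_apply', Function.iterate_succ_apply']
        exact hf _ _ _ (ih m m' (Nat.le_of_succ_le_succ hm) (Nat.le_of_succ_le_succ hm'))
    exact fun p hp => key (p.length + 1) _ _ le_rfl (hp.trans_le hkm) p (Nat.lt_succ_self _)

theorem Guarded.map_lim {f : Tree → Tree} (hf : Guarded f) : f (lim f) = lim f := by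
  have hf' := hf
  rcases hf' with h | h
  · exact h _
  · refine eq_of_eqUpTo fun k => ?_
    have h₁ := (h k _ _ (hf.lim_eqUpTo_iterate (le_refl k))).mono (Nat.le_succ k)
    rw [← Function.iterate_succ_apply' f] at h₁
    exact h₁.trans (hf.lim_eqUpTo_iterate (Nat.le_succ k)).symm

theorem eq_of_fixed {f : Tree → Tree} (hf : ∀ k t u, EqUpTo k t u → EqUpTo (k + 1) (f t) (f u))
    {t u : Tree} (ht : t = f t) (hu : u = f u) : t = u := by
  refine eq_of_eqUpTo fun k => ?_
  induction k with
  | zero => exact fun p hp => absurd hp (Nat.not_lt_zero _)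
  | succ k ih =>
    rw [ht, hu]
    exact hf k _ _ ih

/-- Subtyping of trees, as far as it can be observed at depth less than `k`. -/
def Le : ℕ → Tree → Tree → Prop
  | 0, _, _ => True
  | k + 1, t, u => u [] = .top ∨ (t [] = u [] ∧ (t [] = .arrow →
      Le k (child false u) (child false t) ∧ Le k (child true t) (child true u)))

theorem Le.refl (k : ℕ) : ∀ t, Le k t t := by
  induction k with
  | zero => exact fun _ => trivial
  | succ k ih => exact fun t => Or.inr ⟨rfl, fun _ => ⟨ih _, ih _⟩⟩

theorem Le.trans {k : ℕ} : ∀ {t u v : Tree}, Le k t u → Le k u v → Le k t v := by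
  induction k with
  | zero => exact fun _ _ => trivial
  | succ k ih =>
    intro t u v h h'
    rcases h' with h' | ⟨e', h'⟩
    · exact Or.inl h'
    rcases h with h | ⟨e, h⟩
    · exact Or.inl (e' ▸ h)
    · refine Or.inr ⟨e.trans e', fun ha => ?_⟩
      have h₁ := h ha
      have h₂ := h' (e ▸ ha)
      exact ⟨ih h₂.1 h₁.1, ih h₁.2 h₂.2⟩

theorem Le.congr {k : ℕ} : ∀ {t t' u u' : Tree}, EqUpTo k t t' → EqUpTo k u u' → Le k t u →
    Le k t' u' := by
  induction k with
  | zero => exact fun _ _ _ => trivial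
  | succ k ih =>
    intro t t' u u' ht hu h
    have et := ht [] (Nat.succ_pos k)
    have eu := hu [] (Nat.succ_pos k)
    rcases h with h | ⟨e, h⟩
    · exact Or.inl (eu ▸ h)
    · refine Or.inr ⟨by rw [← et, ← eu, e], fun ha => ?_⟩
      obtain ⟨h₁, h₂⟩ := h (et.trans ha)
      exact ⟨ih (hu.child _) (ht.child _) h₁, ih (ht.child _) (hu.child _) h₂⟩

theorem Le.node {k : ℕ} {t t' u u' : Tree} (h : Le k u t) (h' : Le k t' u') :
    Le k (node t t') (node u u') := by
  cases k with
  | zero => trivial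
  | succ k =>
    have mono : ∀ (k : ℕ) (t u : Tree), Le (k + 1) t u → Le k t u := by
      intro k
      induction k with
      | zero => exact fun _ _ _ => trivial
      | succ k ih =>
        rintro t u (h | ⟨e, h⟩)
        · exact Or.inl h
        · exact Or.inr ⟨e, fun ha => ⟨ih _ _ (h ha).1, ih _ _ (h ha).2⟩⟩
    exact Or.inr ⟨rfl, fun _ => ⟨mono _ _ _ h, mono _ _ _ h'⟩⟩

/-- `Le k` only sees depths below `k`, where guardedness lets the `k`-th iterates replace the
limits; these are related by induction from the meaningless tree. -/
theorem Le.lim {k : ℕ} {f g : Tree → Tree} (hf : Guarded f) (hg : Guarded g)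
    (h : ∀ t u, Le k t u → Le k (f t) (g u)) : Le k (lim f) (lim g) := by
  have key : ∀ m, Le k (f^[m] fun _ => .bot) (g^[m] fun _ => .bot) := by
    intro m
    induction m with
    | zero => exact .refl _ _
    | succ m ih =>
      rw [Function.iterate_succ_apply', Function.iterate_succ_apply']
      exact h _ _ ih
  exact Le.congr (hf.lim_eqUpTo_iterate le_rfl).symm (hg.lim_eqUpTo_iterate le_rfl).symm (key k)

end Tree

open RecTypes.Tree

/-! ### The tree denoted by a type -/

/-- The infinite tree denoted by a type, given trees for its free variables. -/
def Ty.denote : {n : ℕ} → Ty n → (Fin n → Tree) → Tree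
  | _, .int, _ => fun _ => .int
  | _, .top, _ => fun _ => .top
  | _, .var i, ρ => ρ i
  | _, .arrow A B, ρ => node (A.denote ρ) (B.denote ρ)
  | _, .mu A, ρ => lim fun t => A.denote (Fin.cases t ρ)

theorem Ty.denote_rename {m : ℕ} (A : Ty m) : ∀ {n : ℕ} (r : Fin m → Fin n) (ρ : Fin n → Tree),
    (A.rename r).denote ρ = A.denote (ρ ∘ r) := by
  induction A with
  | int => intros; rfl
  | top => intros; rfl
  | var i => intros; rfl
  | arrow A B ihA ihB => intros; simp only [Ty.rename, Ty.denote, ihA, ihB]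
  | mu A ih =>
    intro n r ρ
    simp only [Ty.rename, Ty.denote, ih]
    congr 1
    funext t
    congr 1
    funext i
    cases i using Fin.cases <;> rfl

theorem Ty.denote_subst {m : ℕ} (A : Ty m) : ∀ {n : ℕ} (s : Fin m → Ty n) (ρ : Fin n → Tree),
    (A.subst s).denote ρ = A.denote fun i => (s i).denote ρ := by
  induction A with
  | int => intros; rfl
  | top => intros; rfl
  | var i => intros; rfl
  | arrow A B ihA ihB => intros; simp only [Ty.subst, Ty.denote, ihA, ihB]
  | mu A ih =>
    intro n s ρ
    simp only [Ty.subst, Ty.denote, ih]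
    congr 1
    funext t
    congr 1
    funext i
    cases i using Fin.cases with
    | zero => rfl
    | succ i =>
      change ((s i).rename Fin.succ).denote _ = (s i).denote ρ
      rw [Ty.denote_rename]
      rfl

theorem Ty.denote_inst {n : ℕ} (A : Ty (n + 1)) (B : Ty n) (ρ : Fin n → Tree) :
    (A.inst B).denote ρ = A.denote (Fin.cases (B.denote ρ) ρ) := by
  rw [Ty.inst, Ty.denote_subst]
  congr 1
  funext i
  cases i using Fin.cases <;> rfl

theorem Ty.denote_congr {n : ℕ} {A : Ty n} : ∀ {ρ ρ' : Fin n → Tree},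
    (∀ i, A.Occurs i → ρ i = ρ' i) → A.denote ρ = A.denote ρ' := by
  induction A with
  | int => intros; rfl
  | top => intros; rfl
  | var i => intro _ _ h; exact h i rfl
  | arrow A B ihA ihB =>
    intro ρ ρ' h
    simp only [Ty.denote]
    rw [ihA fun i hi => h i (Or.inl hi), ihB fun i hi => h i (Or.inr hi)]
  | mu A ih =>
    intro ρ ρ' h
    simp only [Ty.denote]
    congr 1
    funext t
    refine ih fun i hi => ?_
    cases i using Fin.cases with
    | zero => rfl
    | succ i => exact h i hi

theorem Ty.denote_eqUpTo {n : ℕ} (A : Ty n) : ∀ {k : ℕ} {ρ ρ' : Fin n → Tree},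
    (∀ i, EqUpTo k (ρ i) (ρ' i)) → EqUpTo k (A.denote ρ) (A.denote ρ') := by
  induction A with
  | int => intros; exact .refl _ _
  | top => intros; exact .refl _ _
  | var i => intro _ _ _ h; exact h i
  | arrow A B ihA ihB => intro _ _ _ h; exact ((ihA h).node (ihB h)).mono (Nat.le_succ _)
  | mu A ih =>
    intro k ρ ρ' h
    refine lim_eqUpTo_lim fun t u htu => ih fun i => ?_
    cases i using Fin.cases with
    | zero => exact htu
    | succ i => exact h i

/-- Either the type is the variable `i` under vacuous binders, or `i` only matters below an arrow,
which delays its influence by one level. The other variables are compared one level deeper so that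
the induction passes through `μ`, whose bound variable is one of them. -/
theorem Ty.denote_eq_or_eqUpTo_succ {n : ℕ} (A : Ty n) : ∀ i : Fin n,
    (∀ ρ, A.denote ρ = ρ i) ∨ ∀ (k : ℕ) (ρ ρ' : Fin n → Tree), EqUpTo k (ρ i) (ρ' i) →
      (∀ j, j ≠ i → EqUpTo (k + 1) (ρ j) (ρ' j)) → EqUpTo (k + 1) (A.denote ρ) (A.denote ρ') := by
  induction A with
  | int => exact fun _ => Or.inr fun _ _ _ _ _ => .refl _ _
  | top => exact fun _ => Or.inr fun _ _ _ _ _ => .refl _ _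
  | var j =>
    intro i
    by_cases hij : j = i
    · exact Or.inl fun ρ => congrArg ρ hij
    · exact Or.inr fun _ _ _ _ h => h j hij
  | arrow A B _ _ =>
    intro i
    right
    intro k ρ ρ' h h'
    have : ∀ j, EqUpTo k (ρ j) (ρ' j) := by
      intro j
      by_cases hij : j = i
      · exact hij ▸ h
      · exact (h' j hij).mono (Nat.le_succ _)
    exact (A.denote_eqUpTo this).node (B.denote_eqUpTo this)
  | mu A ih =>
    intro i
    rcases ih i.succ with h | h
    · left
      intro ρ
      funext p
      simp only [Ty.denote, h, lim, Function.iterate_succ_apply']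
      rfl
    · right
      intro k ρ ρ' hi hj
      refine lim_eqUpTo_lim fun t u htu => h k _ _ hi fun j hij => ?_
      cases j using Fin.cases with
      | zero => exact htu
      | succ j => exact hj j fun e => hij (congrArg Fin.succ e)

theorem Ty.guarded_denote {n : ℕ} (A : Ty (n + 1)) (ρ : Fin n → Tree) :
    Guarded fun t => A.denote (Fin.cases t ρ) := by
  rcases A.denote_eq_or_eqUpTo_succ 0 with h | h
  · exact Or.inl fun t => h _
  · refine Or.inr fun k t u htu => h k _ _ htu fun j hj => ?_
    cases j using Fin.cases with
    | zero => exact absurd rfl hj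
    | succ j => exact .refl _ _

theorem Ty.denote_unfold {n : ℕ} (A : Ty (n + 1)) (ρ : Fin n → Tree) :
    (A.inst (.mu A)).denote ρ = (Ty.mu A).denote ρ := by
  rw [Ty.denote_inst]
  exact (A.guarded_denote ρ).map_lim

/-- `Ty.guarded_denote` would also allow the identity, whose fixed points are not unique.
Contractivity excludes it: unfolding preserves the tree, and a function type puts the variable below
a node. -/
theorem Contractive.denote_eqUpTo_succ {n : ℕ} {A : Ty (n + 1)} (hA : Contractive A 0)
    (ρ : Fin n → Tree) (k : ℕ) (t u : Tree) (htu : EqUpTo k t u) :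
    EqUpTo (k + 1) (A.denote (Fin.cases t ρ)) (A.denote (Fin.cases u ρ)) := by
  rcases hA with hA | ⟨A₁, A₂, hA⟩
  · rw [Ty.denote_congr (A := A) (ρ' := Fin.cases u ρ)]
    · exact .refl _ _
    · intro i hi
      cases i using Fin.cases with
      | zero => exact absurd hi hA
      | succ i => rfl
  · have key : ∀ ρ, A.denote ρ = (Ty.arrow A₁ A₂).denote ρ := by
      intro ρ
      generalize Ty.arrow A₁ A₂ = B at hA
      induction hA with
      | refl => rfl
      | tail _ h ih =>
        rw [ih]
        cases h with
        | unfold A => exact (A.denote_unfold ρ).symm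
    have hρ : ∀ i, EqUpTo k ((Fin.cases t ρ : Fin (n + 1) → Tree) i)
        ((Fin.cases u ρ : Fin (n + 1) → Tree) i) := by
      intro i
      cases i using Fin.cases with
      | zero => exact htu
      | succ i => exact .refl _ _
    rw [key, key]
    exact (A₁.denote_eqUpTo hρ).node (A₂.denote_eqUpTo hρ)

theorem TyEq.denote_eq {n : ℕ} {A B : Ty n} (h : TyEq A B) :
    ∀ ρ : Fin n → Tree, A.denote ρ = B.denote ρ := by
  induction h with
  | contract A _ _ hA ih₁ ih₂ =>
    intro ρ
    have h₁ := ih₁ ρ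
    have h₂ := ih₂ ρ
    rw [Ty.denote_inst] at h₁ h₂
    exact eq_of_fixed (hA.denote_eqUpTo_succ ρ) h₁ h₂
  | unfold A => exact fun ρ => (A.denote_unfold ρ).symm
  | mu_cong _ ih => exact fun ρ => congrArg lim (funext fun t => ih _)
  | trans _ _ ih₁ ih₂ => exact fun ρ => (ih₁ ρ).trans (ih₂ ρ)
  | refl A => exact fun ρ => rfl
  | symm _ ih => exact fun ρ => (ih ρ).symm
  | arrow _ _ ih₁ ih₂ => exact fun ρ => congrArg₂ node (ih₁ ρ) (ih₂ ρ)

theorem Sub.denote_le {m : Mode} {n : ℕ} {E : Env n} {A B : Ty n} (h : Sub m E A B) (k : ℕ) :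
    ∀ ρ : Fin n → Tree, (∀ p ∈ E, Le k (ρ p.1) (ρ p.2)) → Le k (A.denote ρ) (B.denote ρ) := by
  induction h with
  | top A =>
    intro ρ _
    cases k with
    | zero => trivial
    | succ k => exact Or.inl rfl
  | int => exact fun _ _ => .refl _ _
  | eq h => exact fun ρ _ => h.denote_eq ρ ▸ .refl _ _
  | var h => exact fun ρ hρ => hρ _ h
  | self A => exact fun _ _ => .refl _ _
  | trans _ _ ih₁ ih₂ => exact fun ρ hρ => (ih₁ ρ hρ).trans (ih₂ ρ hρ)
  | arrow _ _ ih₁ ih₂ => exact fun ρ hρ => (ih₁ ρ hρ).node (ih₂ ρ hρ)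
  | @mu _ n E A B _ ih =>
    intro ρ hρ
    refine Le.lim (A.guarded_denote ρ) (B.guarded_denote ρ) fun t u htu => ?_
    -- In the extended scope `β` is the variable `0` and `α` the variable `1`, hence this order of
    -- `u` and `t`.
    have h := ih (Fin.cases u (Fin.cases t ρ)) fun p hp => by
      rcases List.mem_cons.1 hp with rfl | hp
      · exact htu
      · obtain ⟨q, hq, rfl⟩ := List.mem_map.1 hp
        exact hρ q hq
    rw [Ty.leftBody, Ty.rightBody, Ty.denote_rename, Ty.denote_rename] at h
    convert h using 2 <;>
    · funext i
      cases i using Fin.cases <;> rfl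

/-! ### Regularity -/

/-- The possible shapes of the tree of a type, up to type equality, the types of the subtrees
being taken from `S`. -/
inductive Shape {n : ℕ} (S : Finset (Ty n)) (A : Ty n) : Prop
  | int : TyEq A .int → Shape S A
  | top : TyEq A .top → Shape S A
  | bot : TyEq A (.mu (.var 0)) → Shape S A
  | var (i : Fin n) : TyEq A (.var i) → Shape S A
  | arrow (A₁ A₂ : Ty n) : A₁ ∈ S → A₂ ∈ S → TyEq A (.arrow A₁ A₂) → Shape S A

theorem Shape.mono {n : ℕ} {S S' : Finset (Ty n)} {A : Ty n} (hS : S ⊆ S') (h : Shape S A) :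
    Shape S' A := by
  cases h with
  | int h => exact .int h
  | top h => exact .top h
  | bot h => exact .bot h
  | var i h => exact .var i h
  | arrow A₁ A₂ h₁ h₂ h => exact .arrow A₁ A₂ (hS h₁) (hS h₂) h

theorem Shape.of_tyEq {n : ℕ} {S : Finset (Ty n)} {A B : Ty n} (e : TyEq A B) (h : Shape S B) :
    Shape S A := by
  cases h with
  | int h => exact .int (e.trans h)
  | top h => exact .top (e.trans h)
  | bot h => exact .bot (e.trans h)
  | var i h => exact .var i (e.trans h)
  | arrow A₁ A₂ h₁ h₂ h => exact .arrow A₁ A₂ h₁ h₂ (e.trans h)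

open Classical in
/-- Every type denotes a regular tree. -/
theorem Ty.exists_shapes {n : ℕ} (A : Ty n) :
    ∃ S : Finset (Ty n), A ∈ S ∧ ∀ P ∈ S, Shape S P := by
  induction A with
  | int => exact ⟨{.int}, by simp, fun P hP => .int (Finset.mem_singleton.1 hP ▸ .refl _)⟩
  | top => exact ⟨{.top}, by simp, fun P hP => .top (Finset.mem_singleton.1 hP ▸ .refl _)⟩
  | var i => exact ⟨{.var i}, by simp, fun P hP => .var i (Finset.mem_singleton.1 hP ▸ .refl _)⟩
  | arrow A B ihA ihB =>
    obtain ⟨S, hA, hS⟩ := ihA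
    obtain ⟨T, hB, hT⟩ := ihB
    refine ⟨insert (.arrow A B) (S ∪ T), by simp, fun P hP => ?_⟩
    rcases Finset.mem_insert.1 hP with rfl | hP
    · exact .arrow A B (by simp [hA]) (by simp [hB]) (.refl _)
    · rcases Finset.mem_union.1 hP with hP | hP
      · exact (hS P hP).mono (Finset.subset_union_left.trans (Finset.subset_insert _ _))
      · exact (hT P hP).mono (Finset.subset_union_right.trans (Finset.subset_insert _ _))
  | mu A ih =>
    obtain ⟨S, hA, hS⟩ := ih
    -- Subtrees of `μ α. A` are instances of subtrees of `A`, except that reaching `α` restarts at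
    -- `μ α. A`.
    set f : Ty (_ + 1) → Ty _ := fun P => P.inst (.mu A) with hf
    set T := insert (Ty.mu A) (S.image f) with hT
    have mem : ∀ P ∈ S, f P ∈ T := fun P hP =>
      Finset.mem_insert_of_mem (Finset.mem_image_of_mem f hP)
    have key : ∀ P ∈ S, Shape T (f P) ∨ TyEq P (.var 0) := by
      intro P hP
      cases hS P hP with
      | int h => exact Or.inl (.int (h.subst _))
      | top h => exact Or.inl (.top (h.subst _))
      | bot h => exact Or.inl (.bot (h.subst _))
      | var i h =>
        cases i using Fin.cases with
        | zero => exact Or.inr h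
        | succ i => exact Or.inl (.var i (h.subst _))
      | arrow A₁ A₂ h₁ h₂ h => exact Or.inl (.arrow _ _ (mem _ h₁) (mem _ h₂) (h.subst _))
    -- If the body itself equals its bound variable, the restart never makes progress and the tree
    -- is meaningless.
    have hmu : Shape T (.mu A) := by
      rcases key A hA with h | h
      · exact h.of_tyEq (.unfold A)
      · exact .bot h.mu_cong
    refine ⟨T, Finset.mem_insert_self _ _, fun P hP => ?_⟩
    rcases Finset.mem_insert.1 hP with rfl | hP
    · exact hmu
    · obtain ⟨P, hPS, rfl⟩ := Finset.mem_image.1 hP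
      rcases key P hPS with h | h
      · exact h
      · exact hmu.of_tyEq (h.subst _)

/-- The root of the tree of a closed type determines its shape. -/
theorem Shape.of_root {S : Finset (Ty 0)} {P : Ty 0} (h : Shape S P) :
    match P.denote Fin.elim0 [] with
    | .bot => TyEq P (.mu (.var 0))
    | .int => TyEq P .int
    | .top => TyEq P .top
    | .arrow => ∃ P₁ ∈ S, ∃ P₂ ∈ S, TyEq P (.arrow P₁ P₂) := by
  cases h with
  | int h => rw [h.denote_eq]; exact h
  | top h => rw [h.denote_eq]; exact h
  | bot h => rw [h.denote_eq]; exact h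
  | var i h => exact i.elim0
  | arrow P₁ P₂ h₁ h₂ h => rw [h.denote_eq]; exact ⟨P₁, h₁, P₂, h₂, h⟩

/-! ### Synchronizing two types -/

/-- Iso-recursive subtyping, in the direction given by a sign. -/
def SignedSub {n : ℕ} (s : Bool) (E : Env n) (A B : Ty n) : Prop :=
  if s then Sub .iso E A B else Sub .iso E B A

theorem SignedSub.arrow {n : ℕ} {s : Bool} {E : Env n} {A₁ A₂ B₁ B₂ : Ty n}
    (h₁ : SignedSub (!s) E A₁ B₁) (h₂ : SignedSub s E A₂ B₂) :
    SignedSub s E (.arrow A₁ A₂) (.arrow B₁ B₂) := by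
  cases s
  · exact Sub.arrow h₁ h₂
  · exact Sub.arrow h₁ h₂

/-- The pair of variables assumed to be related, in the direction given by a sign. -/
def signedPair {n : ℕ} (s : Bool) (a b : Fin n) : Fin n × Fin n :=
  if s then (a, b) else (b, a)

theorem SignedSub.var {n : ℕ} {s : Bool} {E : Env n} {a b : Fin n} (h : signedPair s a b ∈ E) :
    SignedSub s E (.var a) (.var b) := by
  cases s
  · exact Sub.var h
  · exact Sub.var h

/-- The Amber rule gives variable `1` to the smaller side and `0` to the larger one, so the sign
decides which side receives which. -/
theorem SignedSub.mu {m n : ℕ} {s : Bool} {E : Env n} {A B : Ty (m + 1)} {q r : Fin m → Fin n}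
    (h : SignedSub s E.extend
      (A.rename (Fin.cases (if s then 1 else 0) fun i => (q i).succ.succ))
      (B.rename (Fin.cases (if s then 0 else 1) fun i => (r i).succ.succ))) :
    SignedSub s E ((Ty.mu A).rename q) ((Ty.mu B).rename r) := by
  have e : ∀ (C : Ty (m + 1)) (q : Fin m → Fin n) (x : Fin (n + 2)),
      (C.rename (liftRen q)).rename (Fin.cases x fun i => i.succ.succ) =
        C.rename (Fin.cases x fun i => (q i).succ.succ) := by
    intro C q x
    rw [Ty.rename_rename]
    congr 1
    funext i
    cases i using Fin.cases <;> rfl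
  cases s
  · refine Sub.mu ?_
    rw [Ty.leftBody, Ty.rightBody, e, e]
    exact h
  · refine Sub.mu ?_
    rw [Ty.leftBody, Ty.rightBody, e, e]
    exact h

/-- Subtyping of trees, in the direction given by a sign. -/
def SignedLe (s : Bool) (t u : Tree) : Prop :=
  ∀ k, if s then Le k t u else Le k u t

theorem SignedLe.root {s : Bool} {t u : Tree} (h : SignedLe s t u) :
    (if s then u [] else t []) = .top ∨ t [] = u [] := by
  have h₁ := h 1
  cases s
  · exact h₁.imp id fun h => h.1.symm
  · exact h₁.imp id fun h => h.1

theorem SignedLe.of_node {s : Bool} {t₁ t₂ u₁ u₂ : Tree}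
    (h : SignedLe s (node t₁ t₂) (node u₁ u₂)) : SignedLe (!s) t₁ u₁ ∧ SignedLe s t₂ u₂ := by
  have key : ∀ {t₁ t₂ u₁ u₂ : Tree} {k : ℕ}, Le (k + 1) (node t₁ t₂) (node u₁ u₂) →
      Le k u₁ t₁ ∧ Le k t₂ u₂ := by
    rintro t₁ t₂ u₁ u₂ k (h | ⟨-, h⟩)
    · exact Label.noConfusion h
    · exact h rfl
  cases s
  · exact ⟨fun k => (key (h (k + 1))).1, fun k => (key (h (k + 1))).2⟩
  · exact ⟨fun k => (key (h (k + 1))).1, fun k => (key (h (k + 1))).2⟩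

/-- If `P` equals the body `X` of a recursive type with `P` for the bound variable, then `P` equals
the recursive type. -/
theorem TyEq.mu_of_arrow {k : ℕ} {P P₁ P₂ : Ty 0} {X₁ X₂ : Ty (k + 1)} {σ : Fin k → Ty 0}
    (hP : TyEq P (.arrow P₁ P₂)) (h₁ : TyEq (X₁.subst (Fin.cases P σ)) P₁)
    (h₂ : TyEq (X₂.subst (Fin.cases P σ)) P₂) :
    TyEq ((Ty.mu (.arrow X₁ X₂)).subst σ) P := by
  -- Both types solve the equation whose right-hand side is the body `X₁ → X₂`, which is contractive
  -- because it already is a function type.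
  refine .contract ((Ty.arrow X₁ X₂).subst (liftSub σ)) (.unfold _) ?_
    (Or.inr ⟨_, _, .refl⟩)
  rw [Ty.inst_subst_liftSub]
  exact hP.trans (.arrow h₁.symm h₂.symm)

/-- The types `X` and `Y` over the states `L` represent `P` and `Q`, and are subtypes of each other
in the direction given by `s`, provided that the variables for each state are. -/
structure Synchronized {k : ℕ} (L : Fin k → Ty 0 × Ty 0 × Bool) (P Q : Ty 0) (s : Bool)
    (X Y : Ty k) : Prop where
  left : TyEq (X.subst fun i => (L i).1) P
  right : TyEq (Y.subst fun i => (L i).2.1) Q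
  -- A state has one index in `X` and `Y`, but the Amber rule uses distinct variables on the two
  -- sides; the independent renamings `q` and `r` separate them.
  sub {n : ℕ} (E : Env n) (q r : Fin k → Fin n) :
    (∀ i, signedPair (L i).2.2 (q i) (r i) ∈ E) → SignedSub s E (X.rename q) (Y.rename r)

theorem Synchronized.of_root_top {k : ℕ} (L : Fin k → Ty 0 × Ty 0 × Bool) {P Q : Ty 0} {s : Bool}
    (h : TyEq (if s then Q else P) .top) : ∃ X Y, Synchronized L P Q s X Y := by
  cases s
  · exact ⟨.top, Q.rename Fin.elim0, h.symm, (Ty.subst_weaken Q _).symm ▸ .refl _,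
      fun _ _ _ _ => Sub.top _⟩
  · exact ⟨P.rename Fin.elim0, .top, (Ty.subst_weaken P _).symm ▸ .refl _, h.symm,
      fun _ _ _ _ => Sub.top _⟩

theorem Synchronized.mu {k : ℕ} {L : Fin k → Ty 0 × Ty 0 × Bool} {P P₁ P₂ Q Q₁ Q₂ : Ty 0}
    {s : Bool} {X₁ X₂ Y₁ Y₂ : Ty (k + 1)} (hP : TyEq P (.arrow P₁ P₂))
    (hQ : TyEq Q (.arrow Q₁ Q₂))
    (h₁ : Synchronized (Fin.cases (P, Q, s) L) P₁ Q₁ (!s) X₁ Y₁)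
    (h₂ : Synchronized (Fin.cases (P, Q, s) L) P₂ Q₂ s X₂ Y₂) :
    Synchronized L P Q s (.mu (.arrow X₁ X₂)) (.mu (.arrow Y₁ Y₂)) := by
  have eL : (fun i => ((Fin.cases (P, Q, s) L : Fin (k + 1) → Ty 0 × Ty 0 × Bool) i).1) =
      Fin.cases P fun i => (L i).1 := by
    funext i
    cases i using Fin.cases <;> rfl
  have eR : (fun i => ((Fin.cases (P, Q, s) L : Fin (k + 1) → Ty 0 × Ty 0 × Bool) i).2.1) =
      Fin.cases Q fun i => (L i).2.1 := by
    funext i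
    cases i using Fin.cases <;> rfl
  refine ⟨hP.mu_of_arrow (eL ▸ h₁.left) (eL ▸ h₂.left),
    hQ.mu_of_arrow (eR ▸ h₁.right) (eR ▸ h₂.right), fun E q r hE => SignedSub.mu ?_⟩
  have hE' : ∀ i, signedPair ((Fin.cases (P, Q, s) L : Fin (k + 1) → Ty 0 × Ty 0 × Bool) i).2.2
      ((Fin.cases (if s then 1 else 0) fun i => (q i).succ.succ : Fin (k + 1) → Fin _) i)
      ((Fin.cases (if s then 0 else 1) fun i => (r i).succ.succ : Fin (k + 1) → Fin _) i) ∈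
        E.extend := by
    intro i
    cases i using Fin.cases with
    -- For a negative sign, both the variables and the order of the pair are swapped, so the
    -- assumption is `(1, 0)` either way.
    | zero => cases s <;> exact List.mem_cons_self
    | succ i =>
      have h := hE i
      refine List.mem_cons_of_mem _ (List.mem_map.2 ⟨_, h, ?_⟩)
      simp only [Fin.cases_succ]
      cases (L i).2.2 <;> rfl
  exact SignedSub.arrow (h₁.sub _ _ _ hE') (h₂.sub _ _ _ hE')

open Classical in
/-- Two types whose trees are related have synchronized representations. The states outside `U`
are those that already have a variable. -/
theorem exists_synchronized {S : Finset (Ty 0)} (hS : ∀ P ∈ S, Shape S P)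
    (U : Finset (Ty 0 × Ty 0 × Bool)) :
    ∀ {k : ℕ} (L : Fin k → Ty 0 × Ty 0 × Bool) (P Q : Ty 0) (s : Bool),
      (∀ P ∈ S, ∀ Q ∈ S, ∀ s, (P, Q, s) ∈ U ∨ ∃ i, L i = (P, Q, s)) → P ∈ S → Q ∈ S →
      SignedLe s (P.denote Fin.elim0) (Q.denote Fin.elim0) → ∃ X Y, Synchronized L P Q s X Y := by
  induction U using Finset.strongInduction with
  | H U ih =>
    intro k L P Q s hU hP hQ hle
    -- A seen state closes the loop. The sign belongs to the state because an assumption `α ≤ β` can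
    -- be used in one direction only.
    by_cases hseen : ∃ i, L i = (P, Q, s)
    · obtain ⟨i, hi⟩ := hseen
      refine ⟨.var i, .var i, ?_, ?_, fun E q r hE => SignedSub.var ?_⟩
      · simp only [Ty.subst, hi]
        exact .refl _
      · simp only [Ty.subst, hi]
        exact .refl _
      · have h := hE i
        rwa [hi] at h
    have hPr := (hS P hP).of_root
    have hQr := (hS Q hQ).of_root
    have hroot := hle.root
    have hsame : ∀ C : Ty 0, (∀ t : Bool, ∀ n (E : Env n) (q r : Fin k → Fin n),
        SignedSub t E ((C.rename Fin.elim0 : Ty k).rename q)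
          ((C.rename Fin.elim0 : Ty k).rename r)) →
        TyEq P C → TyEq Q C → ∃ X Y, Synchronized L P Q s X Y := by
      intro C hC hPC hQC
      exact ⟨C.rename Fin.elim0, C.rename Fin.elim0, (Ty.subst_weaken C _).symm ▸ hPC.symm,
        (Ty.subst_weaken C _).symm ▸ hQC.symm, fun E q r _ => hC s _ E q r⟩
    generalize P.denote Fin.elim0 [] = a at hPr hroot
    generalize Q.denote Fin.elim0 [] = b at hQr hroot
    rcases hroot with h | rfl
    · refine Synchronized.of_root_top L ?_
      cases s
      · obtain rfl : a = .top := h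
        exact hPr
      · obtain rfl : b = .top := h
        exact hQr
    cases a with
    | int => exact hsame .int (fun t _ _ _ _ => by cases t <;> exact Sub.int) hPr hQr
    | top => exact Synchronized.of_root_top L (by cases s <;> assumption)
    | bot => exact hsame (.mu (.var 0)) (fun t _ _ _ _ => by cases t <;> exact Sub.self _) hPr hQr
    | arrow =>
      obtain ⟨P₁, hP₁, P₂, hP₂, hP'⟩ := hPr
      obtain ⟨Q₁, hQ₁, Q₂, hQ₂, hQ'⟩ := hQr
      rw [hP'.denote_eq, hQ'.denote_eq] at hle
      obtain ⟨hle₁, hle₂⟩ := hle.of_node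
      have hmem : (P, Q, s) ∈ U := (hU P hP Q hQ s).resolve_right hseen
      -- The current state moves from `U` to the new variable `0`, so `U` shrinks strictly for both
      -- recursive calls.
      have hU' : ∀ P' ∈ S, ∀ Q' ∈ S, ∀ s', (P', Q', s') ∈ U.erase (P, Q, s) ∨
          ∃ i, (Fin.cases (P, Q, s) L : Fin (k + 1) → Ty 0 × Ty 0 × Bool) i =
            (P', Q', s') := by
        intro P' hP' Q' hQ' s'
        by_cases he : (P', Q', s') = (P, Q, s)
        · exact Or.inr ⟨0, he.symm⟩
        · rcases hU P' hP' Q' hQ' s' with h | ⟨i, h⟩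
          · exact Or.inl (Finset.mem_erase.2 ⟨he, h⟩)
          · exact Or.inr ⟨i.succ, h⟩
      obtain ⟨X₁, Y₁, h₁⟩ := ih _ (Finset.erase_ssubset hmem) _ P₁ Q₁ (!s) hU' hP₁ hQ₁ hle₁
      obtain ⟨X₂, Y₂, h₂⟩ := ih _ (Finset.erase_ssubset hmem) _ P₂ Q₂ s hU' hP₂ hQ₂ hle₂
      exact ⟨_, _, Synchronized.mu hP' hQ' h₁ h₂⟩

/-! ### Decomposition of equi-recursive subtyping -/

theorem Ty.rename_elim0 (A : Ty 0) : A.rename Fin.elim0 = A := by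
  have h := Ty.subst_weaken A (Ty.var : Fin 0 → Ty 0)
  rwa [Ty.subst_var] at h

theorem Sub.to_equi {m : Mode} {n : ℕ} {E : Env n} {A B : Ty n} (h : Sub m E A B) :
    Sub .equi E A B := by
  induction h with
  | top A => exact .top A
  | int => exact .eq (.refl _)
  | eq h => exact .eq h
  | var h => exact .var h
  | self A => exact .eq (.refl _)
  | trans _ _ ih₁ ih₂ => exact ih₁.trans ih₂
  | arrow _ _ ih₁ ih₂ => exact .arrow ih₁ ih₂
  | mu _ ih => exact .mu ih

open Classical in
theorem Sub.exists_iso {A B : Ty 0} (h : Sub .equi [] A B) :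
    ∃ C₁ C₂ : Ty 0, TyEq A C₁ ∧ Sub .iso [] C₁ C₂ ∧ TyEq C₂ B := by
  obtain ⟨S, hA, hS⟩ := A.exists_shapes
  obtain ⟨T, hB, hT⟩ := B.exists_shapes
  have hST : ∀ P ∈ S ∪ T, Shape (S ∪ T) P := fun P hP =>
    (Finset.mem_union.1 hP).elim (fun hP => (hS P hP).mono Finset.subset_union_left)
      fun hP => (hT P hP).mono Finset.subset_union_right
  -- The traversal starts with no variables, all states unseen and positive variance.
  obtain ⟨X, Y, hXY⟩ := exists_synchronized hST ((S ∪ T) ×ˢ (S ∪ T) ×ˢ Finset.univ)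
    Fin.elim0 A B true
    (fun P hP Q hQ s => Or.inl (by
      exact Finset.mem_product.2 ⟨hP, Finset.mem_product.2 ⟨hQ, Finset.mem_univ _⟩⟩))
    (Finset.mem_union_left _ hA) (Finset.mem_union_right _ hB)
    fun k => h.denote_le k _ fun _ hp => absurd hp List.not_mem_nil
  have e : ∀ s : Fin 0 → Ty 0, s = Ty.var := fun s => funext fun i => i.elim0
  have hl := hXY.left
  have hr := hXY.right
  have hs : Sub .iso ([] : Env 0) (X.rename Fin.elim0) (Y.rename Fin.elim0) :=
    hXY.sub [] _ _ fun i : Fin 0 => i.elim0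
  rw [e fun _ => _, Ty.subst_var] at hl hr
  rw [Ty.rename_elim0, Ty.rename_elim0] at hs
  exact ⟨X, Y, hl.symm, hs, hr⟩

end RecTypes

theorem mainTheorem5 (A B : RecTypes.Ty 0) :
    RecTypes.Sub .equi [] A B ↔
      ∃ C₁ C₂ : RecTypes.Ty 0,
        RecTypes.TyEq A C₁ ∧ RecTypes.Sub .iso [] C₁ C₂ ∧ RecTypes.TyEq C₂ B :=
  ⟨RecTypes.Sub.exists_iso, fun ⟨_, _, h₁, h, h₂⟩ =>
    (RecTypes.Sub.eq h₁).trans (h.to_equi.trans (.eq h₂))⟩
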